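/- Let $N, K, X, T, E \ge 0$ be integers and let $\mathbb{F}_q$ be a finite field with $q \ge 2N-X-T-E$. A \emph{retrieval scheme} with $N$ servers and $K$ classical messages $W_1,\dots,W_K\in\mathbb{F}_q^L$ consists of the following. The $N$ servers hold one $q$-dimensional qudit each, in a joint (possibly entangled) state prepared in advance, independently of the messages, of the desired index and of all randomness. Server $n$ stores $S_n$, a function of the messages and of some random variable $\omega$. A user who wants $W_\theta$ sends to server $n$ a classical query $Q_n$, a function of $\theta$ and of private randomness $\omega'$ independent of $\omega$. Server $n$ applies to its qudit a unitary that depends only on $n$, $S_n$ and $Q_n$, and sends the qudit to the user. The scheme is - \emph{$X$-secure} if the joint distribution of what any at most $X$ servers store does not depend on the messages; - \emph{$T$-private} if the joint distribution of the queries to any at most $T$ servers does not depend on $\theta$; - \emph{resilient to $E$ unresponsive servers} if, for every set $\mathcal{E}$ of at most $E$ servers, when the qudits of $\mathcal{E}$ are erased (traced out) the user, who knows $\mathcal{E}$, $\theta$ and $\omega'$, can recover $W_\theta$ with probability one by a quantum measurement of the remaining qudits, for all $\theta$, all messages and all values of positive probability of $\omega,\omega'$. The servers' storage, queries and unitaries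 do not depend on $\mathcal{E}$. Its \emph{rate} is $L/N$, the number of $q$-ary symbols of the desired message per qudit of answers (erased qudits are counted). A rate is \emph{achievable} if it is the rate of some $X$-secure, $T$-private scheme, for some $L$, that is resilient to $E$ unresponsive servers. Theorem. The following rate $R_q$ is achievable: $$R_q=\begin{cases}\dfrac{2(N-X-T-E)}{N}, & N-E> X+T\ge N/2,\\[2mm] \max\left(\dfrac{N-2E}{N},\dfrac{N-X-T-E}{N}\right), & N-E\ge N/2> X+T,\\[2mm] \dfrac{N-X-T-E}{N}, & N/2> N-E> X+T.\end{cases}$$ -/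

import Mathlib

open scoped ComplexOrder

universe u

/-! ### Finite-dimensional quantum systems

A quantum system with orthonormal basis indexed by a finite type `ι` has state space `ℂ^ι`.  A
qudit of dimension `q = |F|` has basis indexed by `F`, and `n` qudits together have basis indexed
by the functions from the index set of the qudits to `F`. -/

/-- `ρ` is a density operator: positive semidefinite with trace one. -/
def IsDensityMatrix {ι : Type*} [Fintype ι] (ρ : Matrix ι ι ℂ) : Prop :=
  ρ.PosSemidef ∧ ρ.trace = 1

/-- A quantum measurement (POVM) with outcomes in the finite type `Y`. -/
structure POVM (ι Y : Type*) [Fintype ι] [DecidableEq ι] [Fintype Y] where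
  effect : Y → Matrix ι ι ℂ
  posSemidef : ∀ y, (effect y).PosSemidef
  sum_eq_one : ∑ y, effect y = 1

/-- The probability that the measurement `M` of a system in state `ρ` gives the outcome `y`. -/
def POVM.prob {ι Y : Type*} [Fintype ι] [DecidableEq ι] [Fintype Y] (M : POVM ι Y)
    (ρ : Matrix ι ι ℂ) (y : Y) : ℂ :=
  (M.effect y * ρ).trace

/-- The tensor product `U 0 ⊗ U 1 ⊗ ⋯` of operators acting on the individual qudits. -/
def localOp {F : Type*} {N : ℕ} (U : Fin N → Matrix F F ℂ) :
    Matrix (Fin N → F) (Fin N → F) ℂ :=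
  Matrix.of fun x y => ∏ n, U n (x n) (y n)

/-- The basis label of all `N` qudits assembled from the labels `x` of the qudits outside `ℰ`
and the labels `z` of the qudits in `ℰ`. -/
def glue {F : Type*} {N : ℕ} (ℰ : Finset (Fin N)) (x : {n // n ∉ ℰ} → F)
    (z : {n // n ∈ ℰ} → F) : Fin N → F :=
  fun n => if h : n ∈ ℰ then z ⟨n, h⟩ else x ⟨n, h⟩

/-- The state of the remaining qudits after the qudits in `ℰ` are erased: the partial trace of
`ρ` over the qudits in `ℰ`. -/
def eraseQudits {F : Type*} [Fintype F] {N : ℕ} (ℰ : Finset (Fin N))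
    (ρ : Matrix (Fin N → F) (Fin N → F) ℂ) :
    Matrix ({n // n ∉ ℰ} → F) ({n // n ∉ ℰ} → F) ℂ :=
  Matrix.of fun x y => ∑ z : {n // n ∈ ℰ} → F, ρ (glue ℰ x z) (glue ℰ y z)

/-! ### Quantum private information retrieval -/

/-- A quantum private information retrieval scheme with `N` servers holding one qudit each of
dimension `|F|`, and `K` classical messages of `L` symbols of `F` each.

* `state` is the joint state of the `N` qudits, prepared in advance: it depends neither on the
  messages, nor on the desired index, nor on any of the random variables.
* `store W ω n` is what server `n` stores when the messages are `W` and the randomness of the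
  storage is `ω`.
* `query θ ω' n` is the query sent to server `n` when message `θ` is desired and the private
  randomness of the user is `ω'`; the user knows neither the messages nor `ω`, and `ω`, `ω'`
  are independent.
* `op n s a` is the unitary that server `n` applies to its own qudit when its storage is `s` and
  its query is `a`, before it sends the qudit to the user. -/
structure QPIRScheme (F : Type u) [Fintype F] [DecidableEq F] (N K L : ℕ) : Type (u + 1) where
  state : Matrix (Fin N → F) (Fin N → F) ℂ
  isDensityMatrix_state : IsDensityMatrix state
  StoreRand : Type u
  storeLaw : PMF StoreRand
  Store : Type u
  store : (Fin K → Fin L → F) → StoreRand → Fin N → Store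
  QueryRand : Type u
  queryLaw : PMF QueryRand
  Query : Type u
  query : Fin K → QueryRand → Fin N → Query
  op : Fin N → Store → Query → Matrix.unitaryGroup F ℂ

namespace QPIRScheme

variable {F : Type u} [Fintype F] [DecidableEq F] {N K L : ℕ}

/-- `X`-secure storage: the joint law of what any at most `X` servers store is the same for all
values of the messages. -/
def IsSecure (𝒮 : QPIRScheme F N K L) (X : ℕ) : Prop :=
  ∀ 𝒳 : Finset (Fin N), 𝒳.card ≤ X → ∀ W W' : Fin K → Fin L → F,
    𝒮.storeLaw.map (fun ω (n : {n // n ∈ 𝒳}) => 𝒮.store W ω n) =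
      𝒮.storeLaw.map (fun ω (n : {n // n ∈ 𝒳}) => 𝒮.store W' ω n)

/-- `T`-private queries: the joint law of the queries to any at most `T` servers is the same for
all desired indices. -/
def IsPrivate (𝒮 : QPIRScheme F N K L) (T : ℕ) : Prop :=
  ∀ 𝒯 : Finset (Fin N), 𝒯.card ≤ T → ∀ θ θ' : Fin K,
    𝒮.queryLaw.map (fun ω' (n : {n // n ∈ 𝒯}) => 𝒮.query θ ω' n) =
      𝒮.queryLaw.map (fun ω' (n : {n // n ∈ 𝒯}) => 𝒮.query θ' ω' n)

/-- The joint state of the `N` qudits after the servers have applied their unitaries. -/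
def answer (𝒮 : QPIRScheme F N K L) (W : Fin K → Fin L → F) (ω : 𝒮.StoreRand)
    (θ : Fin K) (ω' : 𝒮.QueryRand) : Matrix (Fin N → F) (Fin N → F) ℂ :=
  let V : Matrix (Fin N → F) (Fin N → F) ℂ :=
    localOp fun n => (𝒮.op n (𝒮.store W ω n) (𝒮.query θ ω' n) : Matrix F F ℂ)
  V * 𝒮.state * V.conjTranspose

/-- Recovery from any at most `E` unresponsive servers: whatever set `ℰ` of at most `E` qudits is
erased, the user, who knows `ℰ`, the desired index and its own randomness, has a measurement of
the received qudits whose outcome is the desired message with probability one, whatever the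
messages and the randomness of the storage are. -/
def Recovers (𝒮 : QPIRScheme F N K L) (E : ℕ) : Prop :=
  ∀ ℰ : Finset (Fin N), ℰ.card ≤ E → ∀ θ : Fin K, ∀ ω' ∈ 𝒮.queryLaw.support,
    ∃ M : POVM ({n // n ∉ ℰ} → F) (Fin L → F),
      ∀ W : Fin K → Fin L → F, ∀ ω ∈ 𝒮.storeLaw.support,
        M.prob (eraseQudits ℰ (𝒮.answer W ω θ ω')) (W θ) = 1

/-- The rate: symbols of the desired message per qudit of answers; all `N` qudits count, whether
they are received or erased. -/
noncomputable def rate (_𝒮 : QPIRScheme F N K L) : ℝ :=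
  (L : ℝ) / N

end QPIRScheme

/-- `R` is an achievable rate for retrieval of one of `K` messages over `F` from `N` servers, each
holding one qudit of dimension `|F|`, with `X`-secure storage, `T`-private queries and recovery
from any at most `E` unresponsive servers. -/
def IsAchievableRate (F : Type u) [Fintype F] [DecidableEq F] (N K X T E : ℕ) (R : ℝ) : Prop :=
  ∃ (L : ℕ) (𝒮 : QPIRScheme F N K L),
    𝒮.IsSecure X ∧ 𝒮.IsPrivate T ∧ 𝒮.Recovers E ∧ 𝒮.rate = R

/-!
The scheme joins cross-subspace alignment with a stabilizer state of CSS type.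

Fix distinct nodes `α n`, one per server, and poles `f l` off the nodes. A symbol `W k l` is stored
as `W k l + (f l - α n) * p (α n)` with `p` random of degree less than `X`, and the query is the unit
vector of the desired index divided by `f l - α n`, masked by random polynomials of degree less than
`T`. Interpolation makes any `X` stored values and any `T` queries independent of what they hide
(`map_csaStore_eq`, `map_csaQuery_eq`). The sum of the products of storage and query is
`∑ l, W θ l / (f l - α n)` plus the value at `α n` of a polynomial of degree less than `X + T`
(`exists_csa_product`), so a server can compute one value of a codeword in which the desired symbols
and the interference are linearly independent (`fractions_eq_zero`).

The qudits hold the uniform superposition of the Reed-Solomon code `C` of dimension `k`. The symbols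
are split into two parts; each server shifts its qudit by the value of the first part, and applies a
phase given by the value of the second part times a weight. If `ℰ` is erased, two resulting states
are orthogonal unless the shifts differ off `ℰ` by a codeword of `C`, and the phases by a vector
orthogonal to the codewords of `C` that vanish on `ℰ` (`of_eraseQudits_codeState_mul_ne_zero`). With
the right weights the latter are again, off `ℰ`, weighted values of polynomials, of degree less than
`N - k` (`exists_eval_of_orthogonal`). Hence these ambiguities lie in the space of the interference
when `k` and `N - k` are at most `X + T`, and in general only enlarge it to dimension
`max (X + T) k` and `max (X + T) (N - k)`. States with different desired messages are therefore
orthogonal, and one measurement tells them apart with certainty (`exists_povm_prob_eq_one`).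

The two parts can have `N - E - max (X + T) k` and `N - E - max (X + T) (N - k)` symbols. The choice
`k = N / 2` gives `2 * (N - X - T - E)` or `N - 2 * E` symbols in total, and `k = 0` with an empty
second part gives the classical `N - X - T - E`.
-/

/-! ### Perfect discrimination of orthogonal states -/

/-- Any family of square matrices has a joint support projection `P`: it fixes the columns of each
matrix of the family, and kills every matrix whose columns are orthogonal to all of them. -/
theorem exists_support_projection {ι κ : Type*} [Fintype ι] [DecidableEq ι]
    (ρ : κ → Matrix ι ι ℂ) :
    ∃ P : Matrix ι ι ℂ, P.conjTranspose = P ∧ P * P = P ∧ (∀ i, P * ρ i = ρ i) ∧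
      ∀ A : Matrix ι ι ℂ, (∀ i, (ρ i).conjTranspose * A = 0) → P * A = 0 := by
  let e := Matrix.toEuclideanCLM (n := ι) (𝕜 := ℂ)
  let V : Submodule ℂ (EuclideanSpace ℂ ι) := ⨆ i, LinearMap.range (e (ρ i)).toLinearMap
  have hinj : Function.Injective e := EquivLike.injective e
  have hstar : ∀ A, e A.conjTranspose = star (e A) := e.map_star'
  obtain ⟨P, hP⟩ : ∃ P, e P = V.starProjection := EquivLike.surjective e _
  refine ⟨P, ?_, ?_, fun i => ?_, fun A hA => ?_⟩
  · apply hinj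
    rw [hstar, hP]
    exact isSelfAdjoint_starProjection V
  · apply hinj
    rw [map_mul, hP]
    exact V.isIdempotentElem_starProjection
  · apply hinj
    rw [map_mul, hP]
    ext1 v
    exact V.starProjection_eq_self_iff.2 (le_iSup (fun i => LinearMap.range (e (ρ i)).toLinearMap) i
      (LinearMap.mem_range_self _ v))
  · apply hinj
    rw [map_mul, hP, map_zero]
    ext1 v
    refine (Submodule.starProjection_apply_eq_zero_iff V).2 ?_
    have hV : V ≤ (Submodule.span ℂ {e A v})ᗮ := by
      refine iSup_le fun i => ?_
      rintro _ ⟨w, rfl⟩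
      rw [Submodule.mem_orthogonal_singleton_iff_inner_left]
      change inner ℂ (e (ρ i) w) (e A v) = 0
      rw [← ContinuousLinearMap.adjoint_inner_right, ← ContinuousLinearMap.star_eq_adjoint,
        ← hstar, ← mul_apply_eq_comp, ← map_mul, hA i]
      simp
    rw [Submodule.mem_orthogonal]
    intro u hu
    exact Submodule.mem_orthogonal_singleton_iff_inner_left.1 (hV hu)

/-- States with different labels that are mutually orthogonal can be told apart with certainty:
measure the joint support projections of the labels, and count the outcome outside all supports
as an arbitrary label. -/
theorem exists_povm_prob_eq_one {ι κ Y : Type*} [Fintype ι] [DecidableEq ι] [Fintype Y]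
    [Nonempty Y] (ρ : κ → Matrix ι ι ℂ) (label : κ → Y)
    (hherm : ∀ i, (ρ i).conjTranspose = ρ i) (htr : ∀ i, (ρ i).trace = 1)
    (hortho : ∀ i j, label i ≠ label j → ρ i * ρ j = 0) :
    ∃ M : POVM ι Y, ∀ i, M.prob (ρ i) (label i) = 1 := by
  classical
  choose P hPh hPi hPf hPk using fun y : Y =>
    exists_support_projection fun i : {i // label i = y} => ρ i
  have hkill : ∀ y i, label i ≠ y → P y * ρ i = 0 := fun y i hi =>
    hPk y _ fun j => by
      rw [hherm, hortho]
      rw [j.2]; exact Ne.symm hi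
  have hPP : ∀ y y', y ≠ y' → P y * P y' = 0 := fun y y' hy =>
    hPk y _ fun j => by
      have := congrArg Matrix.conjTranspose (hkill y' j (by rw [j.2]; exact hy))
      rwa [Matrix.conjTranspose_mul, hPh, Matrix.conjTranspose_zero] at this
  have hpsd : ∀ Q : Matrix ι ι ℂ, Q.conjTranspose = Q → Q * Q = Q → Q.PosSemidef := by
    intro Q h1 h2
    have := Matrix.posSemidef_conjTranspose_mul_self Q
    rwa [h1, h2] at this
  have hPS : ∀ y, P y * ∑ y', P y' = P y := fun y => by
    rw [Finset.mul_sum, Finset.sum_eq_single y (fun y' _ h => hPP y y' h.symm) (by simp), hPi]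
  have hSS : (∑ y, P y) * ∑ y, P y = ∑ y, P y := by
    rw [Finset.sum_mul]; exact Finset.sum_congr rfl fun y _ => hPS y
  have hR : (1 - ∑ y, P y).PosSemidef := by
    refine hpsd _ ?_ ?_
    · rw [Matrix.conjTranspose_sub, Matrix.conjTranspose_one, Matrix.conjTranspose_sum]
      simp [hPh]
    · rw [sub_mul, mul_sub, mul_sub, hSS]; simp
  obtain ⟨y₀⟩ := ‹Nonempty Y›
  refine ⟨⟨fun y => P y + if y = y₀ then 1 - ∑ y, P y else 0, fun y => ?_, ?_⟩, fun i => ?_⟩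
  · refine (hpsd _ (hPh y) (hPi y)).add ?_
    split_ifs
    · exact hR
    · exact Matrix.PosSemidef.zero
  · simp [Finset.sum_add_distrib]
  · have hfix : P (label i) * ρ i = ρ i := hPf (label i) ⟨i, rfl⟩
    have hRi : (1 - ∑ y, P y) * ρ i = 0 := by
      rw [sub_mul, Finset.sum_mul, Finset.sum_eq_single (label i)
        (fun y _ h => hkill y i h.symm) (by simp), hfix, one_mul, sub_self]
    rw [POVM.prob, add_mul, hfix, ite_mul, hRi, zero_mul, ite_self, add_zero, htr]

/-! ### Erasure of qudits -/

theorem eraseQudits_conjTranspose {F : Type*} [Fintype F] {N : ℕ}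
    (ℰ : Finset (Fin N)) (ρ : Matrix (Fin N → F) (Fin N → F) ℂ) :
    (eraseQudits ℰ ρ).conjTranspose = eraseQudits ℰ ρ.conjTranspose := by
  ext x y
  simp [eraseQudits]

/-- The basis labels of all qudits are the pairs of labels of the remaining and erased qudits. -/
def glueEquiv {F : Type*} {N : ℕ} (ℰ : Finset (Fin N)) :
    ({n // n ∉ ℰ} → F) × ({n // n ∈ ℰ} → F) ≃ (Fin N → F) where
  toFun p := glue ℰ p.1 p.2
  invFun x := (fun n => x n, fun n => x n)
  left_inv p := by
    ext n
    · simp [glue, n.2]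
    · simp [glue, n.2]
  right_inv x := by
    ext n
    simp [glue]

theorem trace_eraseQudits {F : Type*} [Fintype F] {N : ℕ}
    (ℰ : Finset (Fin N)) (ρ : Matrix (Fin N → F) (Fin N → F) ℂ) :
    (eraseQudits ℰ ρ).trace = ρ.trace := by
  simp only [Matrix.trace, Matrix.diag_apply, eraseQudits, Matrix.of_apply]
  rw [← Fintype.sum_prod_type', ← (glueEquiv ℰ).sum_comp]
  rfl

theorem glue_add_restrict {F : Type*} [AddZeroClass F] {N : ℕ} (ℰ : Finset (Fin N))
    (u : {n // n ∉ ℰ} → F) (z : {n // n ∈ ℰ} → F)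
    {s : Fin N → F} (hs : ∀ n ∈ ℰ, s n = 0) :
    glue ℰ (u + fun n : {n // n ∉ ℰ} => s n) z = glue ℰ u z + s := by
  ext n
  by_cases h : n ∈ ℰ <;> simp [glue, h, hs]

/-! ### Superpositions over a linear code -/

section CodeState

variable {F : Type*} [Field F] [Fintype F] {N : ℕ}

/-- The operator `Z b * X a` on one qudit: the shift `|x⟩ ↦ |x + a⟩` followed by the phase
`|x⟩ ↦ ψ (b * x) |x⟩`. -/
def shiftPhase [DecidableEq F] (ψ : AddChar F ℂ) (a b : F) : Matrix.unitaryGroup F ℂ :=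
  ⟨Matrix.of fun x y => if y = x - a then ψ (b * x) else 0, by
    rw [Matrix.mem_unitaryGroup_iff]
    ext x y
    rw [Matrix.mul_apply, Finset.sum_eq_single (x - a)]
    · by_cases h : x = y
      · subst h
        simp [← AddChar.map_neg_eq_conj, ← AddChar.map_add_eq_mul]
      · simp [h]
    · intro z _ hz
      simp [hz]
    · simp⟩

open Classical in
/-- The density operator of the state obtained from the uniform superposition of the basis states
of the code `C` by the shift `a` and the phase `b`. -/
noncomputable def codeState (C : Submodule F (Fin N → F)) (ψ : AddChar F ℂ) (a b : Fin N → F) :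
    Matrix (Fin N → F) (Fin N → F) ℂ :=
  Matrix.of fun x y =>
    if x - a ∈ C ∧ y - a ∈ C then (Nat.card C : ℂ)⁻¹ * ψ (∑ n, b n * (x n - y n)) else 0

theorem codeState_conjTranspose (C : Submodule F (Fin N → F)) (ψ : AddChar F ℂ)
    (a b : Fin N → F) : (codeState C ψ a b).conjTranspose = codeState C ψ a b := by
  ext x y
  by_cases hx : x - a ∈ C <;> by_cases hy : y - a ∈ C <;>
    simp [codeState, hx, hy, ← starRingEnd_apply, ← AddChar.map_neg_eq_conj, mul_sub]

theorem trace_codeState (C : Submodule F (Fin N → F)) (ψ : AddChar F ℂ) (a b : Fin N → F) :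
    (codeState C ψ a b).trace = 1 := by
  classical
  have hcard : (Finset.univ.filter fun x : Fin N → F => x - a ∈ C).card = Nat.card C := by
    rw [Nat.card_eq_fintype_card, ← Fintype.card_subtype]
    exact Fintype.card_congr ((Equiv.subRight a).subtypeEquiv fun x => Iff.rfl)
  have h0 : (Nat.card C : ℂ) ≠ 0 := Nat.cast_ne_zero.2 Nat.card_pos.ne'
  simp only [Matrix.trace, Matrix.diag_apply, codeState, Matrix.of_apply, and_self, sub_self,
    mul_zero, Finset.sum_const_zero, AddChar.map_zero_eq_one, mul_one]
  rw [← Finset.sum_filter, Finset.sum_const, hcard, nsmul_eq_mul, mul_inv_cancel₀ h0]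

theorem isDensityMatrix_codeState (C : Submodule F (Fin N → F)) (ψ : AddChar F ℂ) :
    IsDensityMatrix (codeState C ψ 0 0) := by
  classical
  refine ⟨?_, trace_codeState C ψ 0 0⟩
  have h := (Matrix.posSemidef_vecMulVec_self_star (R := ℂ)
    fun x : Fin N → F => if x ∈ C then 1 else 0).smul
      (a := (Nat.card C : ℂ)⁻¹) (inv_nonneg.2 (Nat.cast_nonneg _))
  convert h using 1
  ext x y
  by_cases hx : x ∈ C <;> by_cases hy : y ∈ C <;>
    simp [codeState, Matrix.vecMulVec_apply, hx, hy]

theorem localOp_shiftPhase_apply [DecidableEq F] (ψ : AddChar F ℂ) (a b x y : Fin N → F) :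
    localOp (fun n => (shiftPhase ψ (a n) (b n) : Matrix F F ℂ)) x y =
      if y = x - a then ψ (∑ n, b n * x n) else 0 := by
  simp only [localOp, shiftPhase, Matrix.of_apply]
  split_ifs with h
  · subst h
    have hsum : ψ (∑ n, b n * x n) = ∏ n, ψ (b n * x n) :=
      map_prod ψ.toMonoidHom (fun n => Multiplicative.ofAdd (b n * x n)) Finset.univ
    simp [hsum]
  · obtain ⟨n, hn⟩ := Function.ne_iff.1 h
    exact Finset.prod_eq_zero (Finset.mem_univ n) (if_neg hn)

theorem localOp_shiftPhase_mul_codeState [DecidableEq F] (C : Submodule F (Fin N → F))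
    (ψ : AddChar F ℂ) (a b : Fin N → F) :
    localOp (fun n => (shiftPhase ψ (a n) (b n) : Matrix F F ℂ)) * codeState C ψ 0 0 *
      (localOp fun n => (shiftPhase ψ (a n) (b n) : Matrix F F ℂ)).conjTranspose =
      codeState C ψ a b := by
  ext x y
  simp only [Matrix.mul_apply, Matrix.conjTranspose_apply, localOp_shiftPhase_apply, ite_mul,
    zero_mul, Finset.sum_ite_eq', Finset.mem_univ, if_true, apply_ite star,
    star_zero, mul_ite, mul_zero]
  by_cases hx : x - a ∈ C <;> by_cases hy : y - a ∈ C <;> simp [codeState, hx, hy]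
  rw [← AddChar.map_neg_eq_conj, mul_right_comm, ← AddChar.map_add_eq_mul,
    mul_comm, ← sub_eq_add_neg, ← Finset.sum_sub_distrib]
  simp only [mul_sub]

theorem eraseQudits_codeState_add_right (C : Submodule F (Fin N → F)) (ψ : AddChar F ℂ)
    (ℰ : Finset (Fin N)) (a b : Fin N → F) {s : Fin N → F} (hsC : s ∈ C)
    (hs : ∀ n ∈ ℰ, s n = 0) (x u : {n // n ∉ ℰ} → F) :
    eraseQudits ℰ (codeState C ψ a b) x (u + fun n : {n // n ∉ ℰ} => s n) =
      eraseQudits ℰ (codeState C ψ a b) x u * ψ (-∑ n, b n * s n) := by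
  simp only [eraseQudits, Matrix.of_apply, Finset.sum_mul]
  refine Finset.sum_congr rfl fun z _ => ?_
  have hmem : glue ℰ u z + s - a ∈ C ↔ glue ℰ u z - a ∈ C := by
    rw [add_sub_right_comm]
    exact C.add_mem_iff_left hsC
  have harg : ∑ n, b n * (glue ℰ x z n - (glue ℰ u z + s) n) =
      ∑ n, b n * (glue ℰ x z n - glue ℰ u z n) + -∑ n, b n * s n := by
    rw [← Finset.sum_neg_distrib, ← Finset.sum_add_distrib]
    refine Finset.sum_congr rfl fun n _ => ?_
    rw [Pi.add_apply]
    ring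
  simp only [glue_add_restrict ℰ u z hs, codeState, Matrix.of_apply, harg, ite_mul, zero_mul,
    mul_assoc, AddChar.map_add_eq_mul]
  classical
  exact if_congr (and_congr_right fun _ => hmem) rfl rfl

theorem eraseQudits_codeState_add_left (C : Submodule F (Fin N → F)) (ψ : AddChar F ℂ)
    (ℰ : Finset (Fin N)) (a b : Fin N → F) {s : Fin N → F} (hsC : s ∈ C)
    (hs : ∀ n ∈ ℰ, s n = 0) (u y : {n // n ∉ ℰ} → F) :
    eraseQudits ℰ (codeState C ψ a b) (u + fun n : {n // n ∉ ℰ} => s n) y =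
      eraseQudits ℰ (codeState C ψ a b) u y * ψ (∑ n, b n * s n) := by
  have hherm := (eraseQudits_conjTranspose ℰ (codeState C ψ a b)).trans
    (congrArg _ (codeState_conjTranspose C ψ a b))
  rw [← hherm, Matrix.conjTranspose_apply, Matrix.conjTranspose_apply,
    eraseQudits_codeState_add_right C ψ ℰ a b hsC hs, star_mul', AddChar.map_neg_eq_conj,
    starRingEnd_apply, star_star]

/-- The errors that survive the erasure of `ℰ`: if the remaining parts of two shifted and phased
code states are not orthogonal, the difference of the shifts agrees off `ℰ` with a codeword, and the
difference of the phases is orthogonal to every codeword that vanishes on `ℰ`. -/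
theorem of_eraseQudits_codeState_mul_ne_zero {C : Submodule F (Fin N → F)} {ψ : AddChar F ℂ}
    (hψ : ψ ≠ 1) {ℰ : Finset (Fin N)} {a b a' b' : Fin N → F}
    (h : eraseQudits ℰ (codeState C ψ a b) * eraseQudits ℰ (codeState C ψ a' b') ≠ 0) :
    (∃ c ∈ C, ∀ n, n ∉ ℰ → c n = (a - a') n) ∧
      ∀ s ∈ C, (∀ n ∈ ℰ, s n = 0) → ∑ n, (b - b') n * s n = 0 := by
  refine ⟨?_, ?_⟩
  · by_contra! hc
    refine h (Matrix.ext fun x y => ?_)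
    rw [Matrix.mul_apply, Matrix.zero_apply]
    refine Finset.sum_eq_zero fun u _ => ?_
    simp only [eraseQudits, Matrix.of_apply, Finset.sum_mul_sum]
    refine Finset.sum_eq_zero fun z _ => Finset.sum_eq_zero fun z' _ => ?_
    simp only [codeState, Matrix.of_apply]
    split_ifs with h1 h2
    · exfalso
      obtain ⟨n, hn, hne⟩ := hc _ (C.sub_mem h2.1 h1.2)
      refine hne ?_
      simp [glue, hn]
    all_goals simp
  · by_contra! hc
    obtain ⟨s, hsC, hs, hne⟩ := hc
    obtain ⟨t, ht⟩ := AddChar.ne_one_iff.1 hψ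
    -- Rescale the codeword so that the two phases differ on it.
    let s' : Fin N → F := (t / ∑ n, (b - b') n * s n) • s
    have hs' : ∀ n ∈ ℰ, s' n = 0 := fun n hn => by simp [s', hs n hn]
    have hs'C : s' ∈ C := C.smul_mem _ hsC
    have hst : ∑ n, b n * s' n - ∑ n, b' n * s' n = t := by
      rw [← Finset.sum_sub_distrib]
      calc ∑ n, (b n * s' n - b' n * s' n)
          = ∑ n, (t / ∑ n, (b - b') n * s n) * ((b - b') n * s n) :=
            Finset.sum_congr rfl fun n _ => by
              simp only [s', Pi.smul_apply, Pi.sub_apply, smul_eq_mul]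
              ring
        _ = t := by rw [← Finset.mul_sum, div_mul_cancel₀ _ hne]
    refine h (Matrix.ext fun x y => ?_)
    rw [Matrix.mul_apply, Matrix.zero_apply]
    set G := ∑ u, eraseQudits ℰ (codeState C ψ a b) x u * eraseQudits ℰ (codeState C ψ a' b') u y
      with hG
    have hinv : G = G * ψ (-t) := by
      rw [hG, Finset.sum_mul, 
        ← Equiv.sum_comp (Equiv.addRight fun n : {n // n ∉ ℰ} => s' n)]
      refine Finset.sum_congr rfl fun u _ => ?_
      rw [Equiv.coe_addRight, eraseQudits_codeState_add_right C ψ ℰ a b hs'C hs',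
        eraseQudits_codeState_add_left C ψ ℰ a' b' hs'C hs', ← hst, neg_sub, sub_eq_add_neg,
        add_comm, AddChar.map_add_eq_mul]
      ring
    have hneg : ψ (-t) ≠ 1 := by
      intro h1
      refine ht ?_
      have := AddChar.map_add_eq_mul ψ (-t) t
      rwa [neg_add_cancel, AddChar.map_zero_eq_one, h1, one_mul, eq_comm] at this
    by_contra hG0
    exact hneg (mul_left_cancel₀ hG0 (by rw [mul_one]; exact hinv.symm))

end CodeState

/-! ### Reed-Solomon codes and their duals -/

open Polynomial in
/-- The Reed-Solomon code of dimension `k`: the values at the nodes `α` of the polynomials of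
degree less than `k`. -/
noncomputable def reedSolomon {F : Type*} [Field F] {N : ℕ} (α : Fin N → F) (k : ℕ) :
    Submodule F (Fin N → F) :=
  (degreeLT F k).map (LinearMap.pi fun n => leval (α n))

theorem mem_reedSolomon {F : Type*} [Field F] {N : ℕ} {α : Fin N → F} {k : ℕ} {c : Fin N → F} :
    c ∈ reedSolomon α k ↔ ∃ p : Polynomial F, p.degree < k ∧ ∀ n, p.eval (α n) = c n := by
  simp only [reedSolomon, Submodule.mem_map, Polynomial.mem_degreeLT, funext_iff,
    LinearMap.pi_apply, Polynomial.leval_apply]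

/-- The column multipliers of the generalized Reed-Solomon codes dual to the Reed-Solomon codes
with nodes `α`. -/
noncomputable def dualWeight {F : Type*} [Field F] {N : ℕ} (α : Fin N → F) (n : Fin N) : F :=
  (∏ m ∈ Finset.univ.erase n, (α n - α m))⁻¹

theorem dualWeight_ne_zero {F : Type*} [Field F] {N : ℕ} {α : Fin N → F}
    (hα : Function.Injective α) (n : Fin N) : dualWeight α n ≠ 0 :=
  inv_ne_zero (Finset.prod_ne_zero_iff.2 fun _ hm =>
    sub_ne_zero.2 fun h => Finset.ne_of_mem_erase hm (hα h).symm)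

/-- The dual of a shortened Reed-Solomon code is a punctured generalized Reed-Solomon code: a vector
orthogonal to all codewords of dimension `k` that vanish on `ℰ` agrees off `ℰ` with a weighted
codeword of dimension `N - k`. -/
theorem exists_eval_of_orthogonal {F : Type*} [Field F] {N : ℕ} {α : Fin N → F}
    (hα : Function.Injective α) {k : ℕ} (ℰ : Finset (Fin N)) (β : Fin N → F)
    (h : ∀ s ∈ reedSolomon α k, (∀ n ∈ ℰ, s n = 0) → ∑ n, β n * s n = 0) :
    ∃ p : Polynomial F, p.degree < (N - k : ℕ) ∧
      ∀ n, n ∉ ℰ → β n = dualWeight α n * p.eval (α n) := by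
  classical
  let p := Lagrange.interpolate ℰᶜ α fun n => β n / dualWeight α n
  have hp : p.degree < (ℰᶜ.card : ℕ) := Lagrange.degree_interpolate_lt _ hα.injOn
  have hpe : ∀ n, n ∉ ℰ → β n = dualWeight α n * p.eval (α n) := fun n hn => by
    rw [Lagrange.eval_interpolate_at_node _ hα.injOn (Finset.mem_compl.2 hn),
      mul_div_cancel₀ _ (dualWeight_ne_zero hα n)]
  refine ⟨p, ?_, hpe⟩
  by_contra hdeg
  have hp0 : p ≠ 0 := by
    rintro h0
    rw [h0, Polynomial.degree_zero] at hdeg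
    exact hdeg (WithBot.bot_lt_coe _)
  rw [Polynomial.degree_eq_natDegree hp0, Nat.cast_lt] at hp hdeg
  have hcard : ℰ.card + ℰᶜ.card = N := by simp [Finset.card_add_card_compl]
  -- The power of `X` that lifts the leading term of `p` to the degree that the weighted sum reads.
  let i := ℰᶜ.card - 1 - p.natDegree
  have hdegs : (Lagrange.nodal ℰ α * Polynomial.X ^ i).degree < (k : WithBot ℕ) := by
    rw [Polynomial.degree_mul, Polynomial.degree_X_pow, Lagrange.degree_nodal]
    norm_cast
    omega
  have hs := h (fun n => (Lagrange.nodal ℰ α * Polynomial.X ^ i).eval (α n))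
    (mem_reedSolomon.2 ⟨_, hdegs, fun _ => rfl⟩) fun n hn => by
      rw [Polynomial.eval_mul, Lagrange.eval_nodal_at_node hn, zero_mul]
  have hq : (p * Polynomial.X ^ i).degree < ((ℰᶜ.card : ℕ) : WithBot ℕ) := by
    rw [Polynomial.degree_mul, Polynomial.degree_X_pow, Polynomial.degree_eq_natDegree hp0]
    norm_cast
    omega
  have hc := Lagrange.coeff_eq_sum (v := α) (s := ℰᶜ) hα.injOn hq
  rw [show ℰᶜ.card - 1 = p.natDegree + i by omega, Polynomial.coeff_mul_X_pow] at hc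
  refine hp0 (Polynomial.leadingCoeff_eq_zero.1 (hc.trans (Eq.trans ?_ hs)))
  rw [← Finset.sum_compl_add_sum ℰ]
  rw [Finset.sum_eq_zero (s := ℰ) fun n hn => ?_, add_zero]
  · refine Finset.sum_congr rfl fun n hn => ?_
    have hn' : n ∉ ℰ := Finset.mem_compl.1 hn
    have hsplit : ∏ m ∈ Finset.univ.erase n, (α n - α m) =
        (∏ m ∈ ℰᶜ.erase n, (α n - α m)) * ∏ m ∈ ℰ, (α n - α m) := by
      rw [← Finset.prod_union]
      · congr 1
        ext m
        simp only [Finset.mem_erase, Finset.mem_univ, Finset.mem_union, Finset.mem_compl]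
        by_cases hm : m ∈ ℰ
        · simp only [hm, not_true, and_false, false_or, and_true, iff_true]
          rintro rfl
          exact hn' hm
        · simp [hm]
      · exact Finset.disjoint_left.2 fun m hm hm' =>
          Finset.mem_compl.1 (Finset.mem_of_mem_erase hm) hm'
    have h0 : ∏ m ∈ ℰ, (α n - α m) ≠ 0 := Finset.prod_ne_zero_iff.2 fun m hm =>
      sub_ne_zero.2 fun hh => hn' (hα hh ▸ hm)
    have h1 : ∏ m ∈ ℰᶜ.erase n, (α n - α m) ≠ 0 := Finset.prod_ne_zero_iff.2 fun m hm =>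
      sub_ne_zero.2 fun hh => Finset.ne_of_mem_erase hm (hα hh).symm
    rw [hpe n hn', dualWeight, hsplit, Polynomial.eval_mul, Polynomial.eval_mul,
      Lagrange.eval_nodal]
    field_simp
  · simp only [Polynomial.eval_mul, Lagrange.eval_nodal_at_node hn, zero_mul, mul_zero]

/-! ### Cross-subspace alignment -/

/-- Simple fractions with poles off the nodes are independent of the polynomials: `m` fractions
and a polynomial of degree less than `d` that cancel at `m + d` nodes are all zero. -/
theorem fractions_eq_zero {F ι : Type*} [Field F] {α : ι → F} {m d : ℕ} {f : Fin m → F}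
    (hα : Function.Injective α) (hf : Function.Injective f) (hfα : ∀ l n, f l ≠ α n)
    {R : Finset ι} (hR : m + d ≤ R.card) {δ : Fin m → F} {g : Polynomial F} (hg : g.degree < d)
    (h : ∀ n ∈ R, ∑ l, δ l / (f l - α n) + g.eval (α n) = 0) : δ = 0 := by
  classical
  open Polynomial in
  let p : F[X] := ∑ l, C (δ l) * ∏ j ∈ Finset.univ.erase l, (C (f j) - X) +
    g * ∏ j, (C (f j) - X)
  have hdeg1 : ∀ j, (Polynomial.C (f j) - Polynomial.X).degree = 1 := fun j => by
    rw [← neg_sub, Polynomial.degree_neg, Polynomial.degree_X_sub_C]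
  have hp : p.degree < (R.card : ℕ) := by
    have hlt : (m : WithBot ℕ) ≤ R.card := by exact_mod_cast (by omega : m ≤ R.card)
    refine lt_of_le_of_lt (Polynomial.degree_add_le _ _) (max_lt ?_ ?_)
    · refine lt_of_lt_of_le ?_ hlt
      rw [← Polynomial.mem_degreeLT]
      refine Submodule.sum_mem _ fun l _ => ?_
      rw [← Polynomial.smul_eq_C_mul]
      refine Submodule.smul_mem _ _ ?_
      rw [Polynomial.mem_degreeLT, Polynomial.degree_prod]
      simp only [hdeg1, Finset.sum_const, Finset.card_erase_of_mem (Finset.mem_univ l),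
        Finset.card_univ, Fintype.card_fin, nsmul_one]
      have := l.pos
      exact_mod_cast Nat.sub_lt this one_pos
    · rcases eq_or_ne g 0 with rfl | hg0
      · rw [zero_mul, Polynomial.degree_zero]; exact WithBot.bot_lt_coe _
      · rw [Polynomial.degree_mul, Polynomial.degree_prod]
        simp only [hdeg1, Finset.sum_const, Finset.card_univ, Fintype.card_fin, nsmul_one]
        rw [Polynomial.degree_eq_natDegree hg0] at hg ⊢
        norm_cast at hg ⊢
        omega
  have hp0 : p = 0 := by
    refine Polynomial.eq_zero_of_degree_lt_of_eval_index_eq_zero R hα.injOn hp fun n hn => ?_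
    have hsplit : ∀ l, ∏ j, (f j - α n) =
        (f l - α n) * ∏ j ∈ Finset.univ.erase l, (f j - α n) := fun l =>
      (Finset.mul_prod_erase _ _ (Finset.mem_univ l)).symm
    have : p.eval (α n) = (∑ l, δ l / (f l - α n) + g.eval (α n)) * ∏ j, (f j - α n) := by
      simp only [p, Polynomial.eval_add, Polynomial.eval_finsetSum, Polynomial.eval_mul,
        Polynomial.eval_C, Polynomial.eval_prod, Polynomial.eval_sub, Polynomial.eval_X, add_mul,
        Finset.sum_mul]
      congr 1
      refine Finset.sum_congr rfl fun l _ => ?_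
      rw [hsplit l, ← mul_assoc, div_mul_cancel₀ _ (sub_ne_zero.2 (hfα l n))]
    rw [this, h n hn, zero_mul]
  funext l
  have hl : p.eval (f l) = δ l * ∏ j ∈ Finset.univ.erase l, (f j - f l) := by
    simp only [p, Polynomial.eval_add, Polynomial.eval_finsetSum, Polynomial.eval_mul,
      Polynomial.eval_C, Polynomial.eval_prod, Polynomial.eval_sub, Polynomial.eval_X]
    rw [Finset.prod_eq_zero (Finset.mem_univ l) (sub_self _), mul_zero, add_zero,
      Finset.sum_eq_single l _ (by simp)]
    intro j _ hj
    rw [Finset.prod_eq_zero (i := l) (Finset.mem_erase.2 ⟨hj.symm, Finset.mem_univ _⟩)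
      (sub_self _), mul_zero]
  rw [hp0, Polynomial.eval_zero] at hl
  exact (mul_eq_zero.1 hl.symm).resolve_right (Finset.prod_ne_zero_iff.2 fun j hj =>
    sub_ne_zero.2 fun hh => Finset.ne_of_mem_erase hj (hf hh))

/-! ### Masking by random polynomials -/

/-- The polynomial of degree less than `d` with coefficients `r`. -/
noncomputable def maskPoly {F : Type*} [Field F] {d : ℕ} (r : Fin d → F) : Polynomial F :=
  ∑ i : Fin d, Polynomial.monomial (i : ℕ) (r i)

theorem degree_maskPoly_lt {F : Type*} [Field F] {d : ℕ} (r : Fin d → F) :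
    (maskPoly r).degree < d := by
  rw [← Polynomial.mem_degreeLT]
  refine Submodule.sum_mem _ fun i _ => Polynomial.mem_degreeLT.2 ?_
  exact (Polynomial.degree_monomial_le _ _).trans_lt (by exact_mod_cast i.2)

theorem maskPoly_add {F : Type*} [Field F] {d : ℕ} (r r' : Fin d → F) :
    maskPoly (r + r') = maskPoly r + maskPoly r' := by
  simp [maskPoly, Finset.sum_add_distrib]

theorem exists_eval_maskPoly_eq {F : Type*} [Field F] {N d : ℕ} {α : Fin N → F}
    (hα : Function.Injective α) {𝒳 : Finset (Fin N)} (h𝒳 : 𝒳.card ≤ d) (y : Fin N → F) :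
    ∃ r : Fin d → F, ∀ n ∈ 𝒳, (maskPoly r).eval (α n) = y n := by
  let p := Lagrange.interpolate 𝒳 α y
  have hp : p.degree < (d : WithBot ℕ) :=
    (Lagrange.degree_interpolate_lt _ hα.injOn).trans_le (by exact_mod_cast h𝒳)
  refine ⟨fun i => p.coeff i, fun n hn => ?_⟩
  have : maskPoly (fun i : Fin d => p.coeff i) = p := by
    rw [maskPoly, Fin.sum_univ_eq_sum_range (fun i => Polynomial.monomial i (p.coeff i))]
    refine Polynomial.ext fun j => ?_
    rw [Polynomial.finsetSum_coeff]
    simp only [Polynomial.coeff_monomial, Finset.sum_ite_eq', Finset.mem_range]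
    split_ifs with hj
    · rfl
    · exact (Polynomial.coeff_eq_zero_of_degree_lt
        (hp.trans_le (by exact_mod_cast not_lt.1 hj))).symm
  rw [this]
  exact Lagrange.eval_interpolate_at_node _ hα.injOn hn

/-- Two functions of uniform randomness that differ by a translation of the randomness have the
same law. -/
theorem map_uniformOfFintype_eq_of_translate {Ω β : Type*} [Fintype Ω] [AddGroup Ω]
    {g g' : Ω → β} (ω₀ : Ω) (h : ∀ ω, g' ω = g (ω + ω₀)) :
    (PMF.uniformOfFintype Ω).map g = (PMF.uniformOfFintype Ω).map g' := by
  have hinv : (PMF.uniformOfFintype Ω).map (fun ω => ω + ω₀) = PMF.uniformOfFintype Ω := by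
    classical
    ext b
    rw [PMF.map_apply, tsum_eq_single (b - ω₀)]
    · simp
    · intro a ha
      rw [if_neg]
      rintro rfl
      exact ha (by simp)
  rw [show g' = g ∘ fun ω => ω + ω₀ from funext h, ← PMF.map_comp, hinv]

/-! ### The storage and the queries -/

section Scheme

variable {F : Type u} [Field F] {N K L : ℕ}

/-- What server `n` stores: the symbol `l` of the message `k` is masked by a polynomial that is
divisible by `f l - X`. -/
noncomputable def csaStore {X : ℕ} (α : Fin N → F) (f : Fin L → F) (W : Fin K → Fin L → F)
    (ω : Fin L → Fin K → Fin X → F) (n : Fin N) : Fin L → Fin K → F :=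
  fun l k => W k l + (f l - α n) * (maskPoly (ω l k)).eval (α n)

/-- The query to server `n`: the unit vector of the desired index, divided by `f l - X` and masked
by polynomials. -/
noncomputable def csaQuery {T : ℕ} (α : Fin N → F) (f : Fin L → F) (θ : Fin K)
    (ω' : Fin L → Fin K → Fin T → F) (n : Fin N) : Fin L → Fin K → F :=
  fun l k => (if k = θ then 1 else 0) / (f l - α n) + (maskPoly (ω' l k)).eval (α n)

theorem map_csaStore_eq [Fintype F] {X : ℕ} {α : Fin N → F} {f : Fin L → F}
    (hα : Function.Injective α) (hfα : ∀ l n, f l ≠ α n) {𝒳 : Finset (Fin N)} (h𝒳 : 𝒳.card ≤ X)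
    (W W' : Fin K → Fin L → F) :
    (PMF.uniformOfFintype (Fin L → Fin K → Fin X → F)).map
        (fun ω (n : {n // n ∈ 𝒳}) => csaStore α f W ω n) =
      (PMF.uniformOfFintype (Fin L → Fin K → Fin X → F)).map
        (fun ω (n : {n // n ∈ 𝒳}) => csaStore α f W' ω n) := by
  choose ω₀ hω₀ using fun l k => exists_eval_maskPoly_eq hα h𝒳
    fun n => (W' k l - W k l) / (f l - α n)
  refine map_uniformOfFintype_eq_of_translate ω₀ fun ω => ?_
  funext n l k
  have hne := sub_ne_zero.2 (hfα l n)
  simp only [csaStore, Pi.add_apply, maskPoly_add, Polynomial.eval_add, hω₀ l k n n.2]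
  field_simp
  ring

theorem map_csaQuery_eq [Fintype F] {T : ℕ} {α : Fin N → F} {f : Fin L → F}
    (hα : Function.Injective α) {𝒯 : Finset (Fin N)} (h𝒯 : 𝒯.card ≤ T) (θ θ' : Fin K) :
    (PMF.uniformOfFintype (Fin L → Fin K → Fin T → F)).map
        (fun ω' (n : {n // n ∈ 𝒯}) => csaQuery α f θ ω' n) =
      (PMF.uniformOfFintype (Fin L → Fin K → Fin T → F)).map
        (fun ω' (n : {n // n ∈ 𝒯}) => csaQuery α f θ' ω' n) := by
  choose ω₀ hω₀ using fun l k => exists_eval_maskPoly_eq hα h𝒯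
    fun n => ((if k = θ' then 1 else 0) - (if k = θ then 1 else 0)) / (f l - α n)
  refine map_uniformOfFintype_eq_of_translate ω₀ fun ω => ?_
  funext n l k
  simp only [csaQuery, Pi.add_apply, maskPoly_add, Polynomial.eval_add, hω₀ l k n n.2]
  ring

/-- Cross-subspace alignment: in the sum of the products of storage and query, the desired symbols
are the coefficients of simple fractions, and all interference is a polynomial of degree less than
`X + T` in the node. -/
theorem exists_csa_product {X T m : ℕ} {α : Fin N → F} {f : Fin L → F}
    (hfα : ∀ l n, f l ≠ α n) (e : Fin m → Fin L) (W : Fin K → Fin L → F)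
    (ω : Fin L → Fin K → Fin X → F) (θ : Fin K) (ω' : Fin L → Fin K → Fin T → F) :
    ∃ g : Polynomial F, g.degree < (X + T : ℕ) ∧ ∀ n,
      ∑ l, ∑ k, csaStore α f W ω n (e l) k * csaQuery α f θ ω' n (e l) k =
        ∑ l, W θ (e l) / (f (e l) - α n) + g.eval (α n) := by
  let g : Fin L → Fin K → Polynomial F := fun l k =>
    W k l • maskPoly (ω' l k) + (if k = θ then (1 : F) else 0) • maskPoly (ω l k) +
      (Polynomial.C (f l) - Polynomial.X) * (maskPoly (ω l k) * maskPoly (ω' l k))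
  have hg : ∀ l k, g l k ∈ Polynomial.degreeLT F (X + T) := fun l k => by
    refine add_mem (add_mem (Submodule.smul_mem _ _ ?_) (Submodule.smul_mem _ _ ?_)) ?_
    · exact Polynomial.degreeLT_mono (Nat.le_add_left T X)
        (Polynomial.mem_degreeLT.2 (degree_maskPoly_lt _))
    · exact Polynomial.degreeLT_mono (Nat.le_add_right X T)
        (Polynomial.mem_degreeLT.2 (degree_maskPoly_lt _))
    · rcases eq_or_ne (maskPoly (ω l k)) 0 with h | h
      · rw [h, zero_mul, mul_zero]; exact zero_mem _
      rcases eq_or_ne (maskPoly (ω' l k)) 0 with h' | h'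
      · rw [h', mul_zero, mul_zero]; exact zero_mem _
      have h1 := degree_maskPoly_lt (ω l k)
      have h2 := degree_maskPoly_lt (ω' l k)
      rw [Polynomial.mem_degreeLT, Polynomial.degree_mul, Polynomial.degree_mul, ← neg_sub,
        Polynomial.degree_neg, Polynomial.degree_X_sub_C]
      rw [Polynomial.degree_eq_natDegree h] at h1 ⊢
      rw [Polynomial.degree_eq_natDegree h'] at h2 ⊢
      norm_cast at h1 h2 ⊢
      omega
  refine ⟨∑ l, ∑ k, g (e l) k, Polynomial.mem_degreeLT.1 (Submodule.sum_mem _ fun l _ =>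
    Submodule.sum_mem _ fun k _ => hg _ _), fun n => ?_⟩
  rw [Polynomial.eval_finsetSum, ← Finset.sum_add_distrib]
  refine Finset.sum_congr rfl fun l _ => ?_
  have hne := sub_ne_zero.2 (hfα (e l) n)
  have hW : W θ (e l) / (f (e l) - α n) =
      ∑ k, W k (e l) * ((if k = θ then 1 else 0) / (f (e l) - α n)) := by
    simp [div_eq_mul_inv]
  rw [Polynomial.eval_finsetSum, hW, ← Finset.sum_add_distrib]
  refine Finset.sum_congr rfl fun k _ => ?_
  simp only [g, csaStore, csaQuery, Polynomial.eval_add, Polynomial.eval_smul, smul_eq_mul,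
    Polynomial.eval_mul, Polynomial.eval_sub, Polynomial.eval_C, Polynomial.eval_X]
  field_simp
  ring

/-- The retrieval scheme: the qudits hold the superposition of a Reed-Solomon code of dimension `k`,
and each server encodes the aligned products of the first `L₁` symbols into its shift, and those of
the other `L₂` symbols, with the dual weights, into its phase. -/
noncomputable def csaScheme [Fintype F] [DecidableEq F] {L₁ L₂ : ℕ} (K X T k : ℕ) (ψ : AddChar F ℂ)
    (α : Fin N → F) (f : Fin (L₁ + L₂) → F) : QPIRScheme F N K (L₁ + L₂) where
  state := codeState (reedSolomon α k) ψ 0 0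
  isDensityMatrix_state := isDensityMatrix_codeState _ ψ
  StoreRand := Fin (L₁ + L₂) → Fin K → Fin X → F
  storeLaw := PMF.uniformOfFintype _
  Store := Fin (L₁ + L₂) → Fin K → F
  store := csaStore α f
  QueryRand := Fin (L₁ + L₂) → Fin K → Fin T → F
  queryLaw := PMF.uniformOfFintype _
  Query := Fin (L₁ + L₂) → Fin K → F
  query := csaQuery α f
  op n s a := shiftPhase ψ (∑ l : Fin L₁, ∑ k, s (Fin.castAdd L₂ l) k * a (Fin.castAdd L₂ l) k)
    (dualWeight α n * ∑ l : Fin L₂, ∑ k, s (Fin.natAdd L₁ l) k * a (Fin.natAdd L₁ l) k)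

theorem recovers_csaScheme [Fintype F] [DecidableEq F] {L₁ L₂ K X T E k : ℕ}
    {ψ : AddChar F ℂ} (hψ : ψ ≠ 1)
    {α : Fin N → F} {f : Fin (L₁ + L₂) → F} (hα : Function.Injective α)
    (hf₁ : Function.Injective fun l : Fin L₁ => f (Fin.castAdd L₂ l))
    (hf₂ : Function.Injective fun l : Fin L₂ => f (Fin.natAdd L₁ l))
    (hfα : ∀ l n, f l ≠ α n)
    (h₁ : L₁ ≠ 0 → L₁ + max (X + T) k + E ≤ N)
    (h₂ : L₂ ≠ 0 → L₂ + max (X + T) (N - k) + E ≤ N) :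
    (csaScheme K X T k ψ α f).Recovers E := by
  intro ℰ hℰ θ ω' _
  let a : (Fin K → Fin (L₁ + L₂) → F) × (Fin (L₁ + L₂) → Fin K → Fin X → F) → Fin N → F :=
    fun i n => ∑ l : Fin L₁, ∑ k, csaStore α f i.1 i.2 n (Fin.castAdd L₂ l) k *
      csaQuery α f θ ω' n (Fin.castAdd L₂ l) k
  let b : (Fin K → Fin (L₁ + L₂) → F) × (Fin (L₁ + L₂) → Fin K → Fin X → F) → Fin N → F :=
    fun i n => dualWeight α n * ∑ l : Fin L₂, ∑ k, csaStore α f i.1 i.2 n (Fin.natAdd L₁ l) k *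
      csaQuery α f θ ω' n (Fin.natAdd L₁ l) k
  have hans : ∀ i, (csaScheme K X T k ψ α f).answer i.1 i.2 θ ω' =
      codeState (reedSolomon α k) ψ (a i) (b i) := fun i =>
    localOp_shiftPhase_mul_codeState _ ψ (a i) (b i)
  have hcard : ∀ {m d d' d'' : ℕ}, m + max d d' + E ≤ N → d'' ≤ max d d' → m + d'' ≤ ℰᶜ.card := by
    intro m d d' d'' h h'
    rw [Finset.card_compl, Fintype.card_fin]
    omega
  obtain ⟨M, hM⟩ := exists_povm_prob_eq_one
    (fun i => eraseQudits ℰ (codeState (reedSolomon α k) ψ (a i) (b i))) (fun i => i.1 θ)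
    (fun i => by rw [eraseQudits_conjTranspose, codeState_conjTranspose])
    (fun i => by rw [trace_eraseQudits, trace_codeState]) fun i j hij => by
      by_contra hne
      refine hij ?_
      obtain ⟨⟨c, hc, hac⟩, hb⟩ := of_eraseQudits_codeState_mul_ne_zero hψ hne
      obtain ⟨p, hp, hpc⟩ := mem_reedSolomon.1 hc
      obtain ⟨r, hr, hbr⟩ := exists_eval_of_orthogonal hα ℰ _ hb
      -- The interference and the unknown codeword together form a polynomial of degree less than
      -- `max (X + T) d`.
      have key : ∀ {m d : ℕ} (e : Fin m → Fin (L₁ + L₂))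
          (_ : Function.Injective fun l => f (e l))
          (_ : m ≠ 0 → m + max (X + T) d + E ≤ N) (s : Polynomial F) (_ : s.degree < d)
          (_ : ∀ n, n ∉ ℰ → s.eval (α n) =
            ∑ l, ∑ k, csaStore α f i.1 i.2 n (e l) k * csaQuery α f θ ω' n (e l) k -
            ∑ l, ∑ k, csaStore α f j.1 j.2 n (e l) k * csaQuery α f θ ω' n (e l) k),
          ∀ l, i.1 θ (e l) = j.1 θ (e l) := by
        intro m d e hfe hm s hs hsn l
        obtain ⟨g, hg, hgn⟩ := exists_csa_product hfα e i.1 i.2 θ ω'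
        obtain ⟨g', hg', hgn'⟩ := exists_csa_product hfα e j.1 j.2 θ ω'
        have hdeg : (g - g' - s).degree < (max (X + T) d : ℕ) := by
          rw [← Polynomial.mem_degreeLT] at hg hg' hs ⊢
          exact sub_mem (Polynomial.degreeLT_mono (le_max_left _ _) (sub_mem hg hg'))
            (Polynomial.degreeLT_mono (le_max_right _ _) hs)
        have hδ := fractions_eq_zero (δ := fun l => i.1 θ (e l) - j.1 θ (e l)) hα hfe
          (fun l n => hfα (e l) n) (hcard (hm l.pos.ne') le_rfl) hdeg fun n hn => by
            have := hsn n (Finset.mem_compl.1 hn)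
            rw [hgn, hgn'] at this
            simp only [Polynomial.eval_sub, this, sub_div, Finset.sum_sub_distrib]
            ring
        exact sub_eq_zero.1 (congrFun hδ l)
      funext l
      refine Fin.addCases (fun l => ?_) (fun l => ?_) l
      · exact key (Fin.castAdd L₂) hf₁ h₁ p hp (fun n hn => (hpc n).trans (hac n hn)) l
      · refine key (Fin.natAdd L₁) hf₂ h₂ r hr (fun n hn => ?_) l
        refine mul_left_cancel₀ (dualWeight_ne_zero hα n) ((hbr n hn).symm.trans ?_)
        rw [mul_sub]
        rfl
  refine ⟨M, fun W ω _ => ?_⟩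
  have h := hM (W, ω)
  rwa [← hans (W, ω)] at h

/-- The two halves of the symbols of a message may use the same poles, so that `N + max L₁ L₂`
field elements suffice. -/
theorem isAchievableRate_csa [Fintype F] [DecidableEq F] {L₁ L₂ X T E k : ℕ} (K : ℕ)
    (hq : N + max L₁ L₂ ≤ Fintype.card F)
    (h₁ : L₁ ≠ 0 → L₁ + max (X + T) k + E ≤ N)
    (h₂ : L₂ ≠ 0 → L₂ + max (X + T) (N - k) + E ≤ N) :
    IsAchievableRate F N K X T E (((L₁ + L₂ : ℕ) : ℝ) / N) := by
  obtain ⟨ψ, hψ⟩ := AddChar.exists_apply_ne_zero.2 (one_ne_zero : (1 : F) ≠ 0)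
  obtain ⟨φ⟩ := Function.Embedding.nonempty_of_card_le
    (show Fintype.card (Fin (N + max L₁ L₂)) ≤ Fintype.card F by rwa [Fintype.card_fin])
  let α : Fin N → F := fun n => φ (Fin.castAdd _ n)
  let f : Fin (L₁ + L₂) → F := Fin.append
    (fun l => φ (Fin.natAdd N (Fin.castLE (le_max_left _ _) l)))
    (fun l => φ (Fin.natAdd N (Fin.castLE (le_max_right _ _) l)))
  have hα : Function.Injective α := φ.injective.comp (Fin.castAdd_injective _ _)
  have hfα : ∀ l n, f l ≠ α n := by
    intro l n
    refine Fin.addCases (fun l => ?_) (fun l => ?_) l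
    · simp only [f, α, Fin.append_left, ne_eq, φ.injective.eq_iff, Fin.ext_iff, Fin.val_natAdd,
        Fin.val_castAdd]
      omega
    · simp only [f, α, Fin.append_right, ne_eq, φ.injective.eq_iff, Fin.ext_iff, Fin.val_natAdd,
        Fin.val_castAdd]
      omega
  refine ⟨L₁ + L₂, csaScheme K X T k ψ α f, fun 𝒳 h𝒳 W W' => map_csaStore_eq hα hfα h𝒳 W W',
    fun 𝒯 h𝒯 θ θ' => map_csaQuery_eq hα h𝒯 θ θ',
    recovers_csaScheme (AddChar.ne_one_iff.2 ⟨1, hψ⟩) hα ?_ ?_ hfα h₁ h₂, rfl⟩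
  · intro l l' h
    simpa [f, Fin.ext_iff] using h
  · intro l l' h
    simpa [f, Fin.ext_iff] using h

end Scheme

/-! ### The achievable rates -/

theorem mainTheorem1 (F : Type u) [Field F] [Fintype F] [DecidableEq F] (N K X T E : ℕ)
    (hq : 2 * (N : ℤ) - X - T - E ≤ Fintype.card F) :
    ((N : ℝ) - E > X + T → (X : ℝ) + T ≥ N / 2 →
      IsAchievableRate F N K X T E (2 * ((N : ℝ) - X - T - E) / N)) ∧
    ((N : ℝ) - E ≥ N / 2 → (N : ℝ) / 2 > X + T →
      IsAchievableRate F N K X T E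
        (max (((N : ℝ) - 2 * E) / N) (((N : ℝ) - X - T - E) / N))) ∧
    ((N : ℝ) / 2 > N - E → (N : ℝ) - E > X + T →
      IsAchievableRate F N K X T E (((N : ℝ) - X - T - E) / N)) := by
  -- Without phases (`k = 0`, `L₂ = 0`) the scheme is classical.
  have hclassical : X + T + E ≤ N →
      IsAchievableRate F N K X T E (((N : ℝ) - X - T - E) / N) := by
    intro h
    have := isAchievableRate_csa (F := F) (N := N) (L₁ := N - (X + T + E)) (L₂ := 0) (X := X)
      (T := T) (E := E) (k := 0) K (by omega) (by omega) (by omega)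
    convert this using 2
    rw [add_zero, Nat.cast_sub h]
    push_cast
    ring
  refine ⟨fun h1 h2 => ?_, fun h1 h2 => ?_, fun _ h => hclassical ?_⟩
  · have h1' : X + T + E < N := by exact_mod_cast (by linarith : (X : ℝ) + T + E < N)
    have h2' : N ≤ 2 * (X + T) := by exact_mod_cast (by linarith : (N : ℝ) ≤ 2 * (X + T))
    have := isAchievableRate_csa (F := F) (N := N) (L₁ := N - (X + T + E))
      (L₂ := N - (X + T + E)) (X := X) (T := T) (E := E) (k := N / 2) K (by omega) (by omega)
      (by omega)
    convert this using 2
    rw [Nat.cast_add, Nat.cast_sub h1'.le]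
    push_cast
    ring
  · have h1' : 2 * E ≤ N := by exact_mod_cast (by linarith : 2 * (E : ℝ) ≤ N)
    have h2' : 2 * (X + T) < N := by exact_mod_cast (by linarith : 2 * ((X : ℝ) + T) < N)
    rcases le_total (X + T) E with hE | hE
    · have hE' : (X : ℝ) + T ≤ E := by exact_mod_cast hE
      rw [max_eq_right (div_le_div_of_nonneg_right (by linarith) (Nat.cast_nonneg N))]
      exact hclassical (by omega)
    · have hE' : (E : ℝ) ≤ X + T := by exact_mod_cast hE
      rw [max_eq_left (div_le_div_of_nonneg_right (by linarith) (Nat.cast_nonneg N))]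
      -- For odd `N` the two halves of the messages differ by one symbol.
      have := isAchievableRate_csa (F := F) (N := N) (L₁ := N - N / 2 - E) (L₂ := N / 2 - E)
        (X := X) (T := T) (E := E) (k := N / 2) K (by omega) (by omega) (by omega)
      convert this using 2
      rw [show N - N / 2 - E + (N / 2 - E) = N - 2 * E by omega, Nat.cast_sub h1']
      push_cast
      ring
  · exact_mod_cast (by linarith : (X : ℝ) + T + E ≤ N)
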